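/- Let $1\le r<n$ be integers and let $\mu=(\mu_1\ge\cdots\ge\mu_r\ge 0)$ be a partition with $\mu_1\le n-r$ and $|\mu|=(r-1)(n-r-1)$. Let $m(\mu)$ be the number of parts of $\mu$ equal to $n-r$; for $0\le j\le m(\mu)$ let $\mu^j$ be the partition of length $r-j$ obtained from $\mu$ by removing $j$ parts equal to $n-r$; let $|\mathrm{SSYT}_{s}(\nu)|$ be the number of semistandard Young tableaux (rows weakly increasing, columns strictly increasing) of shape $\nu$ with entries in $\{1,\dots,s\}$. Define Klyachko's coefficient $$\Gamma^\mu_{r,n}=\sum_{j=0}^{m(\mu)}(-1)^j\binom{n}{j}\,|\mathrm{SSYT}_{r-j}(\mu^j)|\in\mathbb{Z}.$$ A strip of $\mu$ is a set of exactly $n-r$ boxes of the Young diagram of $\mu$ (drawn left- and top-justified), no two in the same column, such that whenever a box $b_1$ of the set lies in a column to the left of another box $b_2$ of the set, $b_1$ does not lie in a row above that of $b_2$. For a semistandard tableau $T$ of shape $\mu$ with entries in $\{1,\dots,r\}$, an $(i)$-strip ($1\le i\le r$) is a strip all of whose boxes are filled with $i$, and an $(i,i+1)$-strip ($1\le i\le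 r-1$) is a strip all of whose boxes are filled with $i$ or $i+1$ and in which every box filled with $i$ lies in a column to the left of every box filled with $i+1$ (one of the two entries may be absent). Call $T$ 1-strip-less if it has no $(i,i+1)$-strip for any $1\le i\le r-1$ and no $(i)$-strip for any $1\le i\le r$. **Theorem.** $\Gamma^\mu_{r,n}$ is equal to the number of 1-strip-less semistandard Young tableaux of shape $\mu$ with entries in $\{1,\dots,r\}$. In particular, $\Gamma^\mu_{r,n}\ge 0$. -/

import Mathlib

namespace StripLess

/-! Boxes of a Young diagram are pairs `(row, column)`, rows being numbered downwards and columns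
to the right, both from `0`; a partition `μ ⊂ (n - r)^r` is a Young diagram with at most `r` rows
and at most `n - r` columns.  Tableau entries are `1, 2, …, r`, as in the usual convention. -/

/-- The semistandard Young tableaux of shape `μ` filled with entries `1, 2, …, r`. -/
def ssyt (r : ℕ) (μ : YoungDiagram) : Set (SemistandardYoungTableau μ) :=
  {T | ∀ b ∈ μ.cells, 1 ≤ T b.1 b.2 ∧ T b.1 b.2 ≤ r}

/-- There are finitely many such tableaux, so that `Set.ncard` really counts them. -/
theorem ssyt_finite (r : ℕ) (μ : YoungDiagram) : (ssyt r μ).Finite := by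
  classical
  let f : ssyt r μ → (μ.cells → Fin (r + 1)) := fun T b =>
    ⟨T.1 b.1.1 b.1.2, Nat.lt_succ_of_le (T.2 b.1 b.2).2⟩
  have hf : Function.Injective f := by
    intro T T' h
    apply Subtype.ext
    apply SemistandardYoungTableau.ext
    intro i j
    by_cases hc : (i, j) ∈ μ
    · have h1 := congrFun h ⟨(i, j), (YoungDiagram.mem_cells (i, j)).2 hc⟩
      exact congrArg Fin.val h1
    · rw [T.1.zeros hc, T'.1.zeros hc]
  have : Finite (ssyt r μ) := Finite.of_injective f hf
  exact Set.toFinite _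

/-- `m(μ)`: the number of parts of `μ ⊂ (n - r)^r` equal to `n - r`, the largest possible. -/
def numMaxParts (r n : ℕ) (μ : YoungDiagram) : ℕ :=
  ((Finset.range r).filter (fun i => μ.rowLen i = n - r)).card

/-- The partition obtained from `μ` by removing its `j` largest parts, i.e. the top `j` rows of
its diagram.  For `j ≤ m(μ)` these are parts equal to `n - r`, so this is `μ ^ j`. -/
def removeRows (μ : YoungDiagram) (j : ℕ) : YoungDiagram where
  cells := (μ.cells.filter (fun b => j ≤ b.1)).image (fun b => (b.1 - j, b.2))
  isLowerSet := by
    rintro ⟨a, b⟩ ⟨c, d⟩ hle hmem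
    simp only [Finset.coe_image, Finset.coe_filter, Set.mem_image, Set.mem_ofPred_eq,
      Prod.mk.injEq, Prod.exists, YoungDiagram.mem_cells] at hmem ⊢
    obtain ⟨x, y, ⟨hx, hj⟩, rfl, rfl⟩ := hmem
    obtain ⟨h1, h2⟩ := Prod.mk_le_mk.1 hle
    refine ⟨c + j, d, ⟨μ.up_left_mem ?_ h2 hx, ?_⟩, ?_, rfl⟩ <;> omega

theorem mem_removeRows (μ : YoungDiagram) (j i k : ℕ) :
    (i, k) ∈ removeRows μ j ↔ (i + j, k) ∈ μ := by
  rw [← YoungDiagram.mem_cells]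
  simp only [removeRows, Finset.mem_image, Finset.mem_filter, Prod.mk.injEq, Prod.exists,
    YoungDiagram.mem_cells]
  constructor
  · rintro ⟨x, y, ⟨hx, hj⟩, rfl, rfl⟩
    rwa [Nat.sub_add_cancel hj]
  · intro h
    exact ⟨i + j, k, ⟨h, by omega⟩, by omega, rfl⟩

/-- Klyachko's coefficient
`Γ^μ_{r,n} = ∑_{j=0}^{m(μ)} (-1)^j * binom(n, j) * |SSYT_{r-j}(μ^j)|`. -/
noncomputable def klyachkoCoeff (r n : ℕ) (μ : YoungDiagram) : ℤ :=
  ∑ j ∈ Finset.range (numMaxParts r n μ + 1),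
    (-1 : ℤ) ^ j * (n.choose j : ℤ) * ((ssyt (r - j) (removeRows μ j)).ncard : ℤ)

/-- A strip of `μ ⊂ (n - r)^r`: a set of `n - r` boxes of `μ`, no two in the same column, such
that a box lying in a column to the left of another one does not lie in a row above it. -/
def IsStrip (r n : ℕ) (μ : YoungDiagram) (S : Finset (ℕ × ℕ)) : Prop :=
  S ⊆ μ.cells ∧ S.card = n - r ∧
    (∀ b₁ ∈ S, ∀ b₂ ∈ S, b₁ ≠ b₂ → b₁.2 ≠ b₂.2) ∧
    (∀ b₁ ∈ S, ∀ b₂ ∈ S, b₁.2 < b₂.2 → ¬ b₁.1 < b₂.1)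

/-- An `(i)`-strip: a strip all of whose boxes are filled with `i`. -/
def IsSingleStrip (r n : ℕ) {μ : YoungDiagram} (T : SemistandardYoungTableau μ) (i : ℕ)
    (S : Finset (ℕ × ℕ)) : Prop :=
  IsStrip r n μ S ∧ ∀ b ∈ S, T b.1 b.2 = i

/-- An `(i, i+1)`-strip: a strip all of whose boxes are filled with `i` or `i + 1`, all instances
of `i` appearing to the left of all instances of `i + 1`.  (One of the two may be absent.) -/
def IsPairStrip (r n : ℕ) {μ : YoungDiagram} (T : SemistandardYoungTableau μ) (i : ℕ)
    (S : Finset (ℕ × ℕ)) : Prop :=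
  IsStrip r n μ S ∧ (∀ b ∈ S, T b.1 b.2 = i ∨ T b.1 b.2 = i + 1) ∧
    (∀ b₁ ∈ S, ∀ b₂ ∈ S, T b₁.1 b₁.2 = i → T b₂.1 b₂.2 = i + 1 → b₁.2 < b₂.2)

/-- A tableau with entries `1, …, r` is 1-strip-less if it has no `(i, i+1)`-strip with
`1 ≤ i ≤ r - 1` and no `(i)`-strip with `1 ≤ i ≤ r`.  (The second condition follows from the first
one when `r ≥ 2`.) -/
def IsOneStripLess (r n : ℕ) {μ : YoungDiagram} (T : SemistandardYoungTableau μ) : Prop :=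
  (∀ i, 1 ≤ i → i + 1 ≤ r → ¬ ∃ S, IsPairStrip r n T i S) ∧
    (∀ i, 1 ≤ i → i ≤ r → ¬ ∃ S, IsSingleStrip r n T i S)

/-- The 1-strip-less semistandard Young tableaux of shape `μ` with entries `1, 2, …, r`. -/
def oneStripLessSSYT (r n : ℕ) (μ : YoungDiagram) : Set (SemistandardYoungTableau μ) :=
  {T | T ∈ ssyt r μ ∧ IsOneStripLess r n T}

end StripLess

/-! ### Binary words, their gaps, and inclusion–exclusion over long runs. -/

namespace StripLess

open Finset

/-! Put `N = n - r`. A tableau is a binary word of `r` blocks of length `N`, one block per letter,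
recording which columns contain that letter, columns read from right to left. Weak increase along
rows becomes a ballot condition on the residues mod `N` of the zeros (`bijOn_zeroSet`). The size of
`μ` makes the number of zeros `n - 1`, so there are `n` gaps. Inserting `N` ones in a gap shifts
later zeros by `N` and preserves all residues, hence the ballot condition and its content. Words
with `r - j` blocks and the same content encode the tableaux of shape `μ^j`. So `binom(n, j) *
|SSYT_{r-j}(μ^j)|` counts words for `μ` with `j` marked gaps of at least `N` ones, and the
alternating sum counts words with no such gap (`sum_neg_one_pow_ncard_gapVectors`). Finally, `N`
consecutive ones in the word amount to an `(i)`-strip or an `(i, i+1)`-strip (`isOneStripLess_iff`).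
-/

/-- The position of the `i`-th zero of the binary word `1^(ℓ 0) 0 1^(ℓ 1) 0 ⋯`. -/
def zeroPos (ℓ : ℕ → ℕ) (i : ℕ) : ℕ := ∑ g ∈ range (i + 1), ℓ g + i

theorem zeroPos_zero (ℓ : ℕ → ℕ) : zeroPos ℓ 0 = ℓ 0 := by simp [zeroPos]

theorem zeroPos_succ (ℓ : ℕ → ℕ) (i : ℕ) :
    zeroPos ℓ (i + 1) = zeroPos ℓ i + ℓ (i + 1) + 1 := by
  simp only [zeroPos]
  rw [sum_range_succ _ (i + 1)]
  omega

theorem zeroPos_strictMono (ℓ : ℕ → ℕ) : StrictMono (zeroPos ℓ) :=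
  strictMono_nat_of_lt_succ fun i => by rw [zeroPos_succ]; omega

theorem zeroPos_injective : Function.Injective zeroPos := by
  intro ℓ ℓ' h
  funext g
  cases g with
  | zero => rw [← zeroPos_zero ℓ, h, zeroPos_zero]
  | succ g =>
    have h1 := zeroPos_succ ℓ g
    have h2 := zeroPos_succ ℓ' g
    rw [h] at h1
    omega

theorem exists_zeroPos_eq {y : ℕ → ℕ} (hy : StrictMono y) : ∃ ℓ, zeroPos ℓ = y := by
  -- Run `g` is the space between zeros `g - 1` and `g`; run `0` has no zero before it.
  refine ⟨fun g => y g - if g = 0 then 0 else y (g - 1) + 1, funext fun i => ?_⟩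
  induction i with
  | zero => simp [zeroPos_zero]
  | succ i ih =>
    rw [zeroPos_succ, ih]
    have := hy (Nat.lt_add_one i)
    simp
    omega

/-- Lengthen by `N` the runs of ones in the gaps belonging to `S`. -/
def insertRuns (N : ℕ) (S : Finset ℕ) (ℓ : ℕ → ℕ) : ℕ → ℕ :=
  fun g => ℓ g + if g ∈ S then N else 0

theorem zeroPos_insertRuns (N : ℕ) (S : Finset ℕ) (ℓ : ℕ → ℕ) (i : ℕ) :
    zeroPos (insertRuns N S ℓ) i = zeroPos ℓ i + N * #{g ∈ range (i + 1) | g ∈ S} := by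
  simp only [zeroPos, insertRuns, sum_add_distrib, ← sum_filter, sum_const, smul_eq_mul]
  ring

/-- The run lengths of words with `d` zeros and length `L - j * N`, in which the residues mod `N`
of the positions of the zeros form a ballot sequence with content `h`. -/
def gapVectors (N d : ℕ) (h : ℕ → ℕ) (L j : ℕ) : Set (ℕ → ℕ) :=
  {ℓ | (∀ g, d < g → ℓ g = 0) ∧ zeroPos ℓ d + j * N = L ∧
    (∀ c < N, #{i ∈ range d | zeroPos ℓ i % N = c} = h c) ∧
    ∀ m ≤ d, ∀ c, c + 1 < N →
      #{i ∈ range m | zeroPos ℓ i % N = c + 1} ≤ #{i ∈ range m | zeroPos ℓ i % N = c}}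

/-- Each zero moves by a multiple of `N`, so only the length of the word changes. -/
theorem insertRuns_mem_gapVectors {N d : ℕ} {h : ℕ → ℕ} {L j : ℕ} {S : Finset ℕ}
    (hS : S ⊆ range (d + 1)) (ℓ : ℕ → ℕ) :
    insertRuns N S ℓ ∈ gapVectors N d h L j ↔ ℓ ∈ gapVectors N d h L (j + #S) := by
  have hc : #{g ∈ range (d + 1) | g ∈ S} = #S := by
    congr 1
    ext g
    simp only [mem_filter]
    exact ⟨fun hg => hg.2, fun hg => ⟨hS hg, hg⟩⟩
  simp only [gapVectors, Set.mem_ofPred_eq, zeroPos_insertRuns, Nat.add_mul_mod_self_left, hc]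
  refine and_congr (forall₂_congr fun g hg => ?_) (and_congr ?_ Iff.rfl)
  · have : g ∉ S := fun h1 => by have := mem_range.1 (hS h1); omega
    simp [insertRuns, this]
  · rw [show zeroPos ℓ d + (j + #S) * N = zeroPos ℓ d + N * #S + j * N by ring]

theorem ncard_gapVectors_card {N d : ℕ} {h : ℕ → ℕ} {L : ℕ} {S : Finset ℕ}
    (hS : S ⊆ range (d + 1)) :
    (gapVectors N d h L #S).ncard =
      {ℓ ∈ gapVectors N d h L 0 | ∀ g ∈ S, N ≤ ℓ g}.ncard := by
  have hinj : Function.Injective (insertRuns N S) := fun ℓ ℓ' he =>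
    funext fun g => Nat.add_right_cancel (congrFun he g)
  rw [← Set.ncard_image_of_injective _ hinj]
  congr 1
  ext ℓ
  simp only [Set.mem_image, Set.mem_ofPred_eq]
  constructor
  · rintro ⟨ℓ', h1, rfl⟩
    refine ⟨(insertRuns_mem_gapVectors hS ℓ').2 (by rwa [zero_add]), fun g hg => ?_⟩
    simp [insertRuns, hg]
  · rintro ⟨h1, h2⟩
    have he : insertRuns N S (fun g => ℓ g - if g ∈ S then N else 0) = ℓ := by
      funext g
      by_cases hg : g ∈ S
      · have := h2 g hg
        simp only [insertRuns, hg, if_true]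
        omega
      · simp [insertRuns, hg]
    refine ⟨_, ?_, he⟩
    have := (insertRuns_mem_gapVectors hS _).1 (he.symm ▸ h1 : insertRuns N S _ ∈ _)
    rwa [zero_add] at this

/-- Inclusion–exclusion over the set of gaps carrying at least `N` ones. -/
theorem sum_neg_one_pow_ncard_gapVectors {N d : ℕ} {h : ℕ → ℕ} {L : ℕ}
    (hfin : (gapVectors N d h L 0).Finite) :
    ∑ j ∈ range (d + 2), (-1 : ℤ) ^ j * ((d + 1).choose j : ℤ) *
        ((gapVectors N d h L j).ncard : ℤ) =
      ({ℓ ∈ gapVectors N d h L 0 | ∀ g ≤ d, ℓ g < N}.ncard : ℤ) := by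
  classical
  set A := hfin.toFinset with hA
  have hcoe : ∀ (p : (ℕ → ℕ) → Prop) [DecidablePred p],
      {ℓ ∈ gapVectors N d h L 0 | p ℓ}.ncard = #{ℓ ∈ A | p ℓ} := by
    intro p _
    rw [← Set.ncard_coe_finset]
    congr 1
    ext ℓ
    simp [hA]
  have h1 := sum_powerset_apply_card
    (fun j => (-1 : ℤ) ^ j * ((gapVectors N d h L j).ncard : ℤ)) (x := range (d + 1))
  rw [card_range] at h1
  have h2 : ∑ j ∈ range (d + 2), (-1 : ℤ) ^ j * ((d + 1).choose j : ℤ) *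
      ((gapVectors N d h L j).ncard : ℤ) = ∑ j ∈ range (d + 1 + 1),
        (d + 1).choose j • ((-1 : ℤ) ^ j * ((gapVectors N d h L j).ncard : ℤ)) :=
    sum_congr rfl fun j _ => by rw [nsmul_eq_mul]; ring
  rw [h2, ← h1, hcoe, card_filter]
  push_cast
  have h3 : ∀ S ∈ (range (d + 1)).powerset,
      (-1 : ℤ) ^ #S * ((gapVectors N d h L #S).ncard : ℤ) =
        ∑ ℓ ∈ A, if ∀ g ∈ S, N ≤ ℓ g then (-1 : ℤ) ^ #S else 0 := by
    intro S hS
    rw [ncard_gapVectors_card (mem_powerset.1 hS), hcoe, ← sum_filter, sum_const, nsmul_eq_mul]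
    ring
  rw [sum_congr rfl h3, sum_comm]
  refine sum_congr rfl fun ℓ _ => ?_
  -- For fixed `ℓ`, the admissible `S` are the subsets of its set of long gaps; their signed sum is
  -- `1` if that set is empty and `0` otherwise.
  have h4 : {S ∈ (range (d + 1)).powerset | ∀ g ∈ S, N ≤ ℓ g} =
      ({g ∈ range (d + 1) | N ≤ ℓ g}).powerset := by
    ext S
    simp only [mem_filter, mem_powerset, subset_iff]
    exact ⟨fun hS g hg => ⟨hS.1 hg, hS.2 g hg⟩, fun hS =>
      ⟨fun g hg => (hS hg).1, fun g hg => (hS hg).2⟩⟩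
  rw [← sum_filter, h4, sum_powerset_neg_one_pow_card]
  refine if_congr ?_ rfl rfl
  simp only [filter_eq_empty_iff, mem_range, not_le, Nat.lt_succ_iff]

/-! ### Words as run lengths versus words as sets of zeros. -/

/-- The number of elements of `Z` below `Q` that are congruent to `c` mod `N`. -/
def residueCount (N : ℕ) (Z : Finset ℕ) (c Q : ℕ) : ℕ := #{q ∈ Z | q < Q ∧ q % N = c}

/-- The sets of zeros of words of length `L` in which the residues mod `N` of the positions of the
zeros form a ballot sequence with content `h`. -/
def ballotSets (N L : ℕ) (h : ℕ → ℕ) : Set (Finset ℕ) :=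
  {Z | Z ⊆ range L ∧ (∀ c < N, residueCount N Z c L = h c) ∧
    ∀ Q c, c + 1 < N → residueCount N Z (c + 1) Q ≤ residueCount N Z c Q}

/-- The set of the first `d` zeros. -/
def zeroImage (d : ℕ) (ℓ : ℕ → ℕ) : Finset ℕ := (range d).image (zeroPos ℓ)

theorem mem_zeroImage {d : ℕ} {ℓ : ℕ → ℕ} {q : ℕ} :
    q ∈ zeroImage d ℓ ↔ ∃ i < d, zeroPos ℓ i = q := by
  simp [zeroImage]

theorem residueCount_zeroImage_zeroPos {N d : ℕ} (ℓ : ℕ → ℕ) {m : ℕ} (hm : m ≤ d) (c : ℕ) :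
    residueCount N (zeroImage d ℓ) c (zeroPos ℓ m) = #{i ∈ range m | zeroPos ℓ i % N = c} := by
  rw [residueCount, ← card_image_of_injective {i ∈ range m | zeroPos ℓ i % N = c}
    (zeroPos_strictMono ℓ).injective]
  congr 1
  ext q
  simp only [mem_filter, mem_zeroImage, mem_image, mem_range]
  constructor
  · rintro ⟨⟨i, hi, rfl⟩, h1, h2⟩
    exact ⟨i, ⟨(zeroPos_strictMono ℓ).lt_iff_lt.1 h1, h2⟩, rfl⟩
  · rintro ⟨i, ⟨h1, h2⟩, rfl⟩
    exact ⟨⟨i, by omega, rfl⟩, zeroPos_strictMono ℓ h1, h2⟩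

/-- Only the number `m` of zeros below `Q` matters, so testing the ballot condition at zeros tests
it on every prefix. -/
theorem exists_residueCount_zeroImage (N d : ℕ) (ℓ : ℕ → ℕ) (Q : ℕ) :
    ∃ m ≤ d, ∀ c, residueCount N (zeroImage d ℓ) c Q =
      #{i ∈ range m | zeroPos ℓ i % N = c} := by
  have hex : ∃ m, d ≤ m ∨ Q ≤ zeroPos ℓ m := ⟨d, Or.inl le_rfl⟩
  classical
  set m := Nat.find hex with hmdef
  have hm : m ≤ d := Nat.find_min' hex (Or.inl le_rfl)
  refine ⟨m, hm, fun c => ?_⟩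
  rw [← residueCount_zeroImage_zeroPos ℓ hm, residueCount, residueCount]
  congr 1
  ext q
  simp only [mem_filter, mem_zeroImage]
  refine and_congr_right ?_
  rintro ⟨i, hi, rfl⟩
  refine and_congr_left fun _ => ?_
  rw [(zeroPos_strictMono ℓ).lt_iff_lt]
  constructor
  · intro h1
    by_contra h2
    have := (zeroPos_strictMono ℓ).monotone (not_lt.1 h2)
    rcases Nat.find_spec hex with h3 | h3 <;> rw [← hmdef] at h3 <;> omega
  · intro h1
    have := Nat.find_min hex h1
    omega

theorem card_eq_sum_residueCount {N L : ℕ} (hN : 0 < N) {Z : Finset ℕ} (hZ : Z ⊆ range L) :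
    #Z = ∑ c ∈ range N, residueCount N Z c L := by
  rw [card_eq_sum_card_fiberwise (f := fun q => q % N) (t := range N)
    (fun q _ => by simpa using Nat.mod_lt q hN)]
  refine sum_congr rfl fun c _ => ?_
  rw [residueCount]
  congr 1
  ext q
  simp only [mem_filter]
  exact ⟨fun h => ⟨h.1, mem_range.1 (hZ h.1), h.2⟩, fun h => ⟨h.1, h.2.2⟩⟩

/-- Runs beyond `d` are empty, so the phantom zeros of index at least `d` fill every position from
`L` on. The finite set of true zeros thus determines the whole enumeration. -/
theorem range_zeroPos {d L : ℕ} {ℓ : ℕ → ℕ} (h1 : ∀ g, d < g → ℓ g = 0) (h2 : zeroPos ℓ d = L) :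
    Set.range (zeroPos ℓ) = {q | q ∈ zeroImage d ℓ ∨ L ≤ q} := by
  have h3 : ∀ i, zeroPos ℓ (d + i) = L + i := by
    intro i
    induction i with
    | zero => exact h2
    | succ i ih => rw [← add_assoc, zeroPos_succ, ih, h1 _ (by omega)]; omega
  ext q
  simp only [Set.mem_range, mem_zeroImage, Set.mem_ofPred_eq]
  constructor
  · rintro ⟨i, rfl⟩
    by_cases hi : i < d
    · exact Or.inl ⟨i, hi, rfl⟩
    · right
      rw [← h2]
      exact (zeroPos_strictMono ℓ).monotone (not_lt.1 hi)
  · rintro (⟨i, _, rfl⟩ | h)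
    · exact ⟨i, rfl⟩
    · exact ⟨d + (q - L), by rw [h3]; omega⟩

theorem bijOn_zeroImage {N d L j : ℕ} {h : ℕ → ℕ} (hN : 0 < N)
    (hd : ∑ c ∈ range N, h c = d) :
    Set.BijOn (zeroImage d) (gapVectors N d h (L + j * N) j) (ballotSets N L h) := by
  refine ⟨?_, ?_, ?_⟩
  · rintro ℓ ⟨h1, h2, h3, h4⟩
    have h2' : zeroPos ℓ d = L := by omega
    refine ⟨?_, ?_, ?_⟩
    · intro q hq
      obtain ⟨i, hi, rfl⟩ := mem_zeroImage.1 hq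
      rw [mem_range, ← h2']
      exact zeroPos_strictMono ℓ hi
    · intro c hc
      rw [← h3 c hc, ← h2', residueCount_zeroImage_zeroPos ℓ le_rfl]
    · intro Q c hc
      obtain ⟨m, hm, he⟩ := exists_residueCount_zeroImage N d ℓ Q
      rw [he, he]
      exact h4 m hm c hc
  · rintro ℓ ⟨h1, h2, -⟩ ℓ' ⟨h1', h2', -⟩ he
    apply zeroPos_injective
    rw [← (zeroPos_strictMono ℓ).range_inj (zeroPos_strictMono ℓ'),
      range_zeroPos h1 (by omega : zeroPos ℓ d = L),
      range_zeroPos h1' (by omega : zeroPos ℓ' d = L), he]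
  · rintro Z ⟨hZ, h1, h2⟩
    classical
    have hcard : #Z = d := by
      rw [card_eq_sum_residueCount hN hZ, ← hd]
      exact sum_congr rfl fun c hc => h1 c (mem_range.1 hc)
    -- Adding the phantom zeros makes the set infinite, so that `Nat.nth` enumerates it strictly
    -- increasingly.
    let p : ℕ → Prop := fun q => q ∈ Z ∨ L ≤ q
    have hp : (Set.ofPred p).Infinite :=
      (Set.Ici_infinite L).mono fun q hq => Or.inr hq
    obtain ⟨ℓ, hℓ⟩ := exists_zeroPos_eq (Nat.nth_strictMono hp)
    have hcount : Nat.count p L = d := by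
      rw [Nat.count_eq_card_filter_range, ← hcard]
      congr 1
      ext q
      simp only [mem_filter, mem_range, p]
      exact ⟨fun hq => hq.2.resolve_right (by omega), fun hq => ⟨mem_range.1 (hZ hq), Or.inl hq⟩⟩
    have hcount' : ∀ i, Nat.count p (L + i) = d + i := by
      intro i
      induction i with
      | zero => exact hcount
      | succ i ih =>
        rw [← add_assoc, Nat.count_succ, ih, if_pos (Or.inr (by omega : L ≤ L + i))]
        omega
    have hpos : ∀ i, zeroPos ℓ (d + i) = L + i := by
      intro i
      rw [hℓ, ← hcount' i]
      exact Nat.nth_count (Or.inr (by omega : L ≤ L + i))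
    have hgap : ∀ g, d < g → ℓ g = 0 := by
      intro g hg
      have e1 := hpos (g - d)
      have e2 := hpos (g - d - 1)
      have e3 := zeroPos_succ ℓ (g - 1)
      rw [show d + (g - d) = g by omega] at e1
      rw [show d + (g - d - 1) = g - 1 by omega] at e2
      rw [show g - 1 + 1 = g by omega] at e3
      omega
    have himg : zeroImage d ℓ = Z := by
      have hr := range_zeroPos hgap (hpos 0)
      rw [hℓ, Nat.range_nth_of_infinite hp] at hr
      ext q
      have hq : (q ∈ Z ∨ L ≤ q) ↔ (q ∈ zeroImage d ℓ ∨ L ≤ q) := Set.ext_iff.1 hr q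
      have hL : q ∈ zeroImage d ℓ → q < L := by
        intro hq
        obtain ⟨i, hi, rfl⟩ := mem_zeroImage.1 hq
        have e := hpos 0
        have := zeroPos_strictMono ℓ hi
        rw [add_zero] at e
        omega
      have hL' : q ∈ Z → q < L := fun hq => mem_range.1 (hZ hq)
      constructor
      · intro h
        exact (hq.2 (Or.inl h)).resolve_right (by have := hL h; omega)
      · intro h
        exact (hq.1 (Or.inl h)).resolve_right (by have := hL' h; omega)
    have hdL : zeroPos ℓ d = L := hpos 0
    refine ⟨ℓ, ⟨hgap, by rw [hdL], ?_, ?_⟩, himg⟩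
    · intro c hc
      rw [← h1 c hc, ← residueCount_zeroImage_zeroPos ℓ le_rfl, himg, hdL]
    · intro m hm c hc
      rw [← residueCount_zeroImage_zeroPos ℓ hm, ← residueCount_zeroImage_zeroPos ℓ hm, himg]
      exact h2 _ c hc

/-- `N` consecutive ones in the word of length `L` with zeros `Z`, starting at position `Q`. -/
def IsWindow (N L : ℕ) (Z : Finset ℕ) (Q : ℕ) : Prop :=
  Q + N ≤ L ∧ ∀ q, Q ≤ q → q < Q + N → q ∉ Z

theorem forall_lt_iff_not_exists_isWindow {N d L : ℕ} (hN : 0 < N) {ℓ : ℕ → ℕ}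
    (hL : zeroPos ℓ d = L) :
    (∀ g ≤ d, ℓ g < N) ↔ ¬ ∃ Q, IsWindow N L (zeroImage d ℓ) Q := by
  have hmono := zeroPos_strictMono ℓ
  constructor
  · rintro h ⟨Q, hQ, hw⟩
    -- The window lies in the run ending at the first zero at or after `Q`, possibly the phantom
    -- zero `d` at position `L`.
    have hex : ∃ g, Q ≤ zeroPos ℓ g := ⟨d, by omega⟩
    classical
    have h1 := Nat.find_spec hex
    have h2 : ∀ g, g < Nat.find hex → zeroPos ℓ g < Q := fun g hg =>
      not_le.1 (Nat.find_min hex hg)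
    set g := Nat.find hex with hg
    have hgd : g ≤ d := Nat.find_min' hex (by omega)
    have h3 : Q + N ≤ zeroPos ℓ g := by
      by_contra h4
      rcases hgd.lt_or_eq with h5 | h5
      · exact hw _ h1 (by omega) (mem_zeroImage.2 ⟨g, h5, rfl⟩)
      · rw [h5] at h4; omega
    have h4 := h g hgd
    cases hgc : g with
    | zero => rw [hgc] at h3 h4; rw [zeroPos_zero] at h3; omega
    | succ g' =>
      have h5 := h2 g' (by omega)
      rw [hgc] at h3 h4
      rw [zeroPos_succ] at h3
      omega
  · intro h g hg
    by_contra h1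
    apply h
    have h2 := hmono.monotone hg
    have h3 : ℓ g ≤ zeroPos ℓ g := by
      cases g with
      | zero => rw [zeroPos_zero]
      | succ g => rw [zeroPos_succ]; omega
    refine ⟨zeroPos ℓ g - ℓ g, by omega, fun q hq1 hq2 hq => ?_⟩
    obtain ⟨i, hi, rfl⟩ := mem_zeroImage.1 hq
    have h4 : i < g := hmono.lt_iff_lt.1 (by omega)
    cases g with
    | zero => omega
    | succ g =>
      have h5 := hmono.monotone (Nat.lt_succ_iff.1 h4)
      rw [zeroPos_succ] at hq1
      omega

end StripLess

/-! ### Tableaux as ballot words. -/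

namespace StripLess

open Finset

/-- The letter `a + 1` occurs in column `k` of `T`. -/
def InCol {ν : YoungDiagram} (T : SemistandardYoungTableau ν) (k a : ℕ) : Prop :=
  ∃ i < ν.colLen k, T i k = a + 1

theorem colLen_le_of_forall_mem {s N : ℕ} {ν : YoungDiagram}
    (hν : ∀ i k : ℕ, (i, k) ∈ ν → i < s ∧ k < N) (k : ℕ) : ν.colLen k ≤ s := by
  by_contra h
  exact absurd (hν s k (YoungDiagram.mem_iff_lt_colLen.2 (not_le.1 h))).1 (lt_irrefl s)

theorem one_le_entry {s : ℕ} {ν : YoungDiagram} {T : SemistandardYoungTableau ν}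
    (hT : T ∈ ssyt s ν) {i k : ℕ} (h : i < ν.colLen k) : 1 ≤ T i k :=
  (hT (i, k) ((YoungDiagram.mem_cells _).2 (YoungDiagram.mem_iff_lt_colLen.2 h))).1

theorem entry_le {s : ℕ} {ν : YoungDiagram} {T : SemistandardYoungTableau ν}
    (hT : T ∈ ssyt s ν) {i k : ℕ} (h : i < ν.colLen k) : T i k ≤ s :=
  (hT (i, k) ((YoungDiagram.mem_cells _).2 (YoungDiagram.mem_iff_lt_colLen.2 h))).2

theorem entry_lt_entry_iff {ν : YoungDiagram} (T : SemistandardYoungTableau ν) {i j k : ℕ}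
    (hi : i < ν.colLen k) (hj : j < ν.colLen k) : T i k < T j k ↔ i < j := by
  rw [← not_le, ← not_le]
  refine not_congr ⟨fun h => ?_, fun h => ?_⟩
  · by_contra h1
    have := T.col_strict (not_le.1 h1) (YoungDiagram.mem_iff_lt_colLen.2 hj)
    omega
  · rcases h.lt_or_eq with h1 | rfl
    · exact (T.col_strict h1 (YoungDiagram.mem_iff_lt_colLen.2 hi)).le
    · exact le_rfl

open scoped Classical in
theorem count_inCol {s : ℕ} {ν : YoungDiagram} {T : SemistandardYoungTableau ν}
    (hT : T ∈ ssyt s ν) (k a : ℕ) :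
    Nat.count (InCol T k) a = #{i ∈ range (ν.colLen k) | T i k ≤ a} := by
  rw [Nat.count_eq_card_filter_range, 
    ← card_image_of_injOn (s := {i ∈ range (ν.colLen k) | T i k ≤ a}) (f := fun i => T i k - 1)]
  · congr 1
    ext b
    simp only [mem_filter, mem_range, mem_image]
    constructor
    · rintro ⟨hb, i, hi, he⟩
      exact ⟨i, ⟨hi, by omega⟩, by omega⟩
    · rintro ⟨i, ⟨hi, h1⟩, rfl⟩
      have := one_le_entry hT hi
      exact ⟨by omega, i, hi, by omega⟩
  · intro i hi j hj he
    simp only [coe_filter, mem_range, Set.mem_ofPred_eq] at hi hj he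
    have h1 := one_le_entry hT hi.1
    have h2 := one_le_entry hT hj.1
    have h3 := entry_lt_entry_iff T hi.1 hj.1
    have h4 := entry_lt_entry_iff T hj.1 hi.1
    omega

open scoped Classical in
theorem count_inCol_eq_colLen {s : ℕ} {ν : YoungDiagram} {T : SemistandardYoungTableau ν}
    (hT : T ∈ ssyt s ν) (k : ℕ) : Nat.count (InCol T k) s = ν.colLen k := by
  rw [count_inCol hT, filter_true_of_mem, card_range]
  exact fun i hi => entry_le hT (mem_range.1 hi)

-- The left neighbour of an entry at most `a` is at most `a`: this is the ballot condition, seen on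
-- the ones.
open scoped Classical in
theorem count_inCol_succ_le {s : ℕ} {ν : YoungDiagram} {T : SemistandardYoungTableau ν}
    (hT : T ∈ ssyt s ν) (k a : ℕ) :
    Nat.count (InCol T (k + 1)) a ≤ Nat.count (InCol T k) a := by
  rw [count_inCol hT, count_inCol hT]
  refine card_le_card fun i hi => ?_
  simp only [mem_filter, mem_range] at hi ⊢
  have h1 := T.row_weak (Nat.lt_succ_self k) (YoungDiagram.mem_iff_lt_colLen.2 hi.1)
  exact ⟨hi.1.trans_le (ν.colLen_anti _ _ (Nat.le_succ k)), h1.trans hi.2⟩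

/-- Columns are strictly increasing, so a column is recovered from its set of letters. -/
theorem nth_inCol {s : ℕ} {ν : YoungDiagram} {T : SemistandardYoungTableau ν}
    (hT : T ∈ ssyt s ν) {i k : ℕ} (hi : i < ν.colLen k) :
    Nat.nth (InCol T k) i + 1 = T i k := by
  classical
  have h1 := one_le_entry hT hi
  have h2 : Nat.count (InCol T k) (T i k - 1) = i := by
    rw [count_inCol hT]
    have : {j ∈ range (ν.colLen k) | T j k ≤ T i k - 1} = range i := by
      ext j
      simp only [mem_filter, mem_range]
      constructor
      · rintro ⟨hj, h⟩
        exact (entry_lt_entry_iff T hj hi).1 (by omega)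
      · intro hj
        have := (entry_lt_entry_iff T (hj.trans hi) hi).2 hj
        exact ⟨hj.trans hi, by omega⟩
    rw [this, card_range]
  have h3 : InCol T k (T i k - 1) := ⟨i, hi, by omega⟩
  have h4 := Nat.nth_count h3
  rw [h2] at h4
  omega

theorem residueCount_mul {N c : ℕ} (hc : c < N) (Z : Finset ℕ) (a : ℕ) :
    residueCount N Z c (a * N) = Nat.count (fun b => b * N + c ∈ Z) a := by
  have hinj : Function.Injective fun b : ℕ => b * N + c := fun b b' h =>
    Nat.eq_of_mul_eq_mul_right (by omega : 0 < N) (Nat.add_right_cancel h)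
  rw [Nat.count_eq_card_filter_range, ← card_image_of_injective _ hinj, residueCount]
  congr 1
  ext q
  simp only [mem_filter, mem_image, mem_range]
  constructor
  · rintro ⟨h1, h2, rfl⟩
    have h3 : q / N * N + q % N = q := by rw [mul_comm]; exact Nat.div_add_mod q N
    exact ⟨q / N, ⟨Nat.div_lt_of_lt_mul (by rwa [mul_comm]), by rwa [h3]⟩, h3⟩
  · rintro ⟨b, ⟨h1, h2⟩, rfl⟩
    refine ⟨h2, ?_, ?_⟩
    · calc b * N + c < (b + 1) * N := by rw [add_mul]; omega
        _ ≤ a * N := Nat.mul_le_mul_right N h1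
    · rw [mul_comm, Nat.mul_add_mod, Nat.mod_eq_of_lt hc]

theorem residueCount_mono (N : ℕ) (Z : Finset ℕ) (c : ℕ) : Monotone (residueCount N Z c) := by
  intro Q Q' h
  refine card_le_card fun q hq => ?_
  simp only [mem_filter] at hq ⊢
  exact ⟨hq.1, hq.2.1.trans_le h, hq.2.2⟩

theorem residueCount_eq_of_forall {N : ℕ} {Z : Finset ℕ} {c Q Q' : ℕ} (hQ : Q ≤ Q')
    (h : ∀ q ∈ Z, Q ≤ q → q < Q' → q % N ≠ c) : residueCount N Z c Q = residueCount N Z c Q' := by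
  rw [residueCount, residueCount]
  congr 1
  ext q
  simp only [mem_filter]
  refine and_congr_right fun hq => ⟨fun h1 => ⟨h1.1.trans_le hQ, h1.2⟩, fun h1 => ⟨?_, h1.2⟩⟩
  by_contra h2
  exact h q hq (not_lt.1 h2) h1.1 h1.2

/-- The ballot condition need only be tested on prefixes consisting of whole blocks. -/
theorem residueCount_succ_le_of_blocks {s N : ℕ} {Z : Finset ℕ} (hZ : Z ⊆ range (s * N))
    (h : ∀ a ≤ s, ∀ c, c + 1 < N → residueCount N Z (c + 1) (a * N) ≤ residueCount N Z c (a * N))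
    (Q c : ℕ) (hc : c + 1 < N) : residueCount N Z (c + 1) Q ≤ residueCount N Z c Q := by
  rcases le_total (s * N) Q with hQ | hQ
  · have h1 : ∀ c, residueCount N Z c (s * N) = residueCount N Z c Q := fun c =>
      residueCount_eq_of_forall hQ fun q hq h1 => by have := mem_range.1 (hZ hq); omega
    rw [← h1, ← h1]
    exact h s le_rfl c hc
  rcases hQ.eq_or_lt with rfl | hQ
  · exact h s le_rfl c hc
  have hN : 0 < N := by omega
  have h1 : Q / N < s := Nat.div_lt_of_lt_mul (by rwa [mul_comm])
  have h2 : Q / N * N + Q % N = Q := by rw [mul_comm]; exact Nat.div_add_mod Q N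
  have h2' := Nat.mod_lt Q hN
  have key : ∀ q, Q / N * N ≤ q → q < (Q / N + 1) * N → q = Q / N * N + q % N := by
    intro q hq1 hq2
    have : q / N = Q / N := by
      apply Nat.div_eq_of_lt_le hq1
      exact hq2
    rw [← this, mul_comm]
    exact (Nat.div_add_mod q N).symm
  have h3 : (Q / N + 1) * N = Q / N * N + N := by ring
  -- Inside a block residue `c` precedes `c + 1`. Either residue `c + 1` has not been passed, and
  -- its count is that of the block's start, or residue `c` has been passed, and its count is that
  -- of the block's end.
  rcases le_or_gt (Q % N) (c + 1) with h4 | h4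
  · rw [← residueCount_eq_of_forall (Q := Q / N * N) (Q' := Q) (c := c + 1) (by omega)]
    · exact (h _ h1.le c hc).trans (residueCount_mono N Z c (by omega))
    · intro q _ hq1 hq2
      have := key q hq1 (by omega)
      omega
  · rw [residueCount_eq_of_forall (Q := Q) (Q' := (Q / N + 1) * N) (c := c) (by omega)]
    · exact (residueCount_mono N Z _ (by omega)).trans (h (Q / N + 1) h1 c hc)
    · intro q _ hq1 hq2
      have := key q (by omega) hq2
      omega

open scoped Classical in
/-- Letter `a + 1` and column `k` correspond to position `a * N + (N - 1 - k)` of a binary word of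
length `s * N`; this is the set of positions for which the letter is absent from the column. -/
noncomputable def zeroSet (s N : ℕ) {ν : YoungDiagram} (T : SemistandardYoungTableau ν) :
    Finset ℕ :=
  {q ∈ range (s * N) | ¬ InCol T (N - 1 - q % N) (q / N)}

theorem block_mod {N c : ℕ} (hc : c < N) (a : ℕ) : (a * N + c) % N = c := by
  rw [mul_comm, Nat.mul_add_mod, Nat.mod_eq_of_lt hc]

theorem block_div {N c : ℕ} (hc : c < N) (a : ℕ) : (a * N + c) / N = a := by
  rw [mul_comm, Nat.mul_add_div (by omega), Nat.div_eq_of_lt hc, add_zero]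

theorem block_lt {s N a c : ℕ} (ha : a < s) (hc : c < N) : a * N + c < s * N :=
  calc a * N + c < (a + 1) * N := by rw [add_mul]; omega
    _ ≤ s * N := Nat.mul_le_mul_right N ha

theorem block_mem_zeroSet {s N : ℕ} {ν : YoungDiagram} (T : SemistandardYoungTableau ν) {a c : ℕ}
    (ha : a < s) (hc : c < N) : a * N + c ∈ zeroSet s N T ↔ ¬ InCol T (N - 1 - c) a := by
  simp only [zeroSet, mem_filter, mem_range, block_mod hc, block_div hc, block_lt ha hc, true_and]

open scoped Classical in
theorem residueCount_zeroSet_add {s N : ℕ} {ν : YoungDiagram} (T : SemistandardYoungTableau ν)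
    {a c : ℕ} (ha : a ≤ s) (hc : c < N) :
    residueCount N (zeroSet s N T) c (a * N) + Nat.count (InCol T (N - 1 - c)) a = a := by
  rw [residueCount_mul hc]
  induction a with
  | zero => simp
  | succ a ih =>
    have h1 := ih (by omega)
    rw [Nat.count_succ, Nat.count_succ]
    have h2 := block_mem_zeroSet T (by omega : a < s) hc
    by_cases h3 : InCol T (N - 1 - c) a
    · rw [if_neg (fun h4 => h2.1 h4 h3), if_pos h3]; omega
    · rw [if_pos (h2.2 h3), if_neg h3]; omega

theorem zeroSet_mem_ballotSets {s N : ℕ} {ν : YoungDiagram} {T : SemistandardYoungTableau ν}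
    (hT : T ∈ ssyt s ν) :
    zeroSet s N T ∈ ballotSets N (s * N) fun c => s - ν.colLen (N - 1 - c) := by
  classical
  refine ⟨filter_subset _ _, fun c hc => ?_, ?_⟩
  · have := residueCount_zeroSet_add T le_rfl hc (s := s)
    rw [count_inCol_eq_colLen hT] at this
    simp only
    omega
  · refine residueCount_succ_le_of_blocks (filter_subset _ _) fun a ha c hc => ?_
    have h1 := residueCount_zeroSet_add T ha hc
    have h2 := residueCount_zeroSet_add T ha (by omega : c < N)
    have h3 := count_inCol_succ_le hT (N - 1 - (c + 1)) a
    rw [show N - 1 - (c + 1) + 1 = N - 1 - c by omega] at h3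
    omega

theorem zeroSet_injOn {s N : ℕ} {ν : YoungDiagram}
    (hν : ∀ i k : ℕ, (i, k) ∈ ν → i < s ∧ k < N) : Set.InjOn (zeroSet s N) (ssyt s ν) := by
  intro T hT T' hT' he
  have hcol : ∀ k < N, InCol T k = InCol T' k := by
    intro k hk
    funext a
    apply propext
    by_cases ha : a < s
    · have h1 := block_mem_zeroSet T ha (by omega : N - 1 - k < N)
      have h2 := block_mem_zeroSet T' ha (by omega : N - 1 - k < N)
      rw [show N - 1 - (N - 1 - k) = k by omega] at h1 h2
      rw [he] at h1
      exact not_iff_not.1 (h1.symm.trans h2)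
    · constructor
      · rintro ⟨i, hi, h⟩
        have := entry_le hT hi
        omega
      · rintro ⟨i, hi, h⟩
        have := entry_le hT' hi
        omega
  apply SemistandardYoungTableau.ext
  intro i k
  by_cases h : (i, k) ∈ ν
  · have h1 := YoungDiagram.mem_iff_lt_colLen.1 h
    rw [← nth_inCol hT h1, ← nth_inCol hT' h1, hcol k (hν i k h).2]
  · rw [T.zeros h, T'.zeros h]

theorem zeroSet_surjOn {s N : ℕ} {ν : YoungDiagram}
    (hν : ∀ i k : ℕ, (i, k) ∈ ν → i < s ∧ k < N) :
    Set.SurjOn (zeroSet s N) (ssyt s ν)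
      (ballotSets N (s * N) fun c => s - ν.colLen (N - 1 - c)) := by
  rintro Z ⟨hZ, hcont, hballot⟩
  classical
  -- `p k` is the intended letter set of column `k`; the bound `a < s` keeps it finite.
  let p : ℕ → ℕ → Prop := fun k a => a < s ∧ a * N + (N - 1 - k) ∉ Z
  have hcount : ∀ k < N, ∀ a ≤ s, residueCount N Z (N - 1 - k) (a * N) + Nat.count (p k) a = a := by
    intro k hk a ha
    rw [residueCount_mul (by omega)]
    induction a with
    | zero => simp
    | succ a ih =>
      have h1 := ih (by omega)
      rw [Nat.count_succ, Nat.count_succ]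
      by_cases h3 : a * N + (N - 1 - k) ∈ Z
      · rw [if_pos h3, if_neg (fun h => h.2 h3)]; omega
      · rw [if_neg h3, if_pos ⟨by omega, h3⟩]; omega
  have htot : ∀ k < N, Nat.count (p k) s = ν.colLen k := by
    intro k hk
    have h1 := hcount k hk s le_rfl
    have h2 : residueCount N Z (N - 1 - k) (s * N) = s - ν.colLen (N - 1 - (N - 1 - k)) :=
      hcont _ (by omega)
    rw [show N - 1 - (N - 1 - k) = k by omega] at h2
    have := colLen_le_of_forall_mem hν k
    omega
  have hlt : ∀ {i k}, i < ν.colLen k → k < N := fun h =>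
    (hν _ _ (YoungDiagram.mem_iff_lt_colLen.2 h)).2
  -- On a finite set `Nat.nth` takes the default value `0` past the last element; this bound
  -- excludes that case.
  have hcard : ∀ {i k}, i < ν.colLen k → ∀ hf : (Set.ofPred (p k)).Finite, i < #hf.toFinset := by
    intro i k hi hf
    refine hi.trans_le ?_
    rw [← htot k (hlt hi), Nat.count_eq_card_filter_range]
    refine card_le_card fun a ha => ?_
    rw [Set.Finite.mem_toFinset]
    exact (mem_filter.1 ha).2
  let T : SemistandardYoungTableau ν :=
    { entry := fun i k => if i < ν.colLen k then Nat.nth (p k) i + 1 else 0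
      row_weak' := by
        intro i j1 j2 hj hmem
        have hi := YoungDiagram.mem_iff_lt_colLen.1 hmem
        have hi' : ∀ {j}, j ≤ j2 → i < ν.colLen j := fun hj => hi.trans_le (ν.colLen_anti _ _ hj)
        simp only [if_pos hi, if_pos (hi' hj.le)]
        have hN := hlt hi
        -- Column `k + 1` has `i + 1` letters up to its `i`-th one; by the ballot condition column
        -- `k` has at least as many, so its `i`-th letter is no larger.
        have hmono : ∀ {k}, k + 1 ≤ j2 → Nat.nth (p k) i ≤ Nat.nth (p (k + 1)) i := by
          intro k hk
          have h1 := (Nat.nth_mem i (hcard (hi' hk))).1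
          have h2 := hcount k (by omega) (Nat.nth (p (k + 1)) i + 1) h1
          have h3 := hcount (k + 1) (by omega) (Nat.nth (p (k + 1)) i + 1) h1
          have h4 := hballot ((Nat.nth (p (k + 1)) i + 1) * N) (N - 1 - (k + 1)) (by omega)
          rw [show N - 1 - (k + 1) + 1 = N - 1 - k by omega] at h4
          have h5 : Nat.count (p (k + 1)) (Nat.nth (p (k + 1)) i + 1) = i + 1 := by
            rw [Nat.count_succ, Nat.count_nth (hcard (hi' hk)),
              if_pos (Nat.nth_mem i (hcard (hi' hk)))]
          exact Nat.lt_add_one_iff.1 (Nat.nth_lt_of_lt_count (by omega))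
        have hle : ∀ m, j1 + m ≤ j2 → Nat.nth (p j1) i ≤ Nat.nth (p (j1 + m)) i := by
          intro m
          induction m with
          | zero => exact fun _ => le_rfl
          | succ m ih => exact fun h => (ih (by omega)).trans (hmono h)
        have := hle (j2 - j1) (by omega)
        rw [show j1 + (j2 - j1) = j2 by omega] at this
        omega
      col_strict' := by
        intro i1 i2 j hi hmem
        have h2 := YoungDiagram.mem_iff_lt_colLen.1 hmem
        simp only [if_pos h2, if_pos (hi.trans h2)]
        exact Nat.succ_lt_succ (Nat.nth_lt_nth' hi (hcard h2))
      zeros' := fun hmem => if_neg fun h => hmem (YoungDiagram.mem_iff_lt_colLen.2 h) }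
  have hT : ∀ {i k}, i < ν.colLen k → T i k = Nat.nth (p k) i + 1 := fun h => if_pos h
  refine ⟨T, ?_, ?_⟩
  · rintro ⟨i, k⟩ hb
    have h1 := YoungDiagram.mem_iff_lt_colLen.1 ((YoungDiagram.mem_cells _).1 hb)
    simp only [hT h1]
    exact ⟨by omega, (Nat.nth_mem i (hcard h1)).1⟩
  · have hcol : ∀ {k a}, k < N → (InCol T k a ↔ p k a) := by
      intro k a hk
      constructor
      · rintro ⟨i, hi, h⟩
        rw [hT hi] at h
        rw [← Nat.succ.inj h]
        exact Nat.nth_mem i (hcard hi)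
      · intro h
        have h1 : Nat.count (p k) a < ν.colLen k := by
          rw [← htot k hk]
          exact Nat.count_strict_mono h h.1
        exact ⟨_, h1, by rw [hT h1, Nat.nth_count h]⟩
    ext q
    by_cases hq : q < s * N
    · have hN : 0 < N := Nat.pos_of_ne_zero fun h => by simp [h] at hq
      have h1 : q / N < s := Nat.div_lt_of_lt_mul (by rwa [mul_comm])
      have h2 : q / N * N + q % N = q := by rw [mul_comm]; exact Nat.div_add_mod q N
      have h3 := Nat.mod_lt q hN
      have h4 := block_mem_zeroSet T h1 h3
      rw [h2, hcol (by omega)] at h4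
      rw [h4]
      simp only [p, h1, true_and, not_not, show N - 1 - (N - 1 - q % N) = q % N by omega, h2]
    · exact ⟨fun h => absurd (mem_range.1 (filter_subset _ _ h)) hq,
        fun h => absurd (mem_range.1 (hZ h)) hq⟩

theorem bijOn_zeroSet {s N : ℕ} {ν : YoungDiagram}
    (hν : ∀ i k : ℕ, (i, k) ∈ ν → i < s ∧ k < N) :
    Set.BijOn (zeroSet s N) (ssyt s ν)
      (ballotSets N (s * N) fun c => s - ν.colLen (N - 1 - c)) :=
  ⟨fun _ hT => zeroSet_mem_ballotSets hT, zeroSet_injOn hν, zeroSet_surjOn hν⟩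

end StripLess

/-! ### Windows of ones versus strips. -/

namespace StripLess

open Finset

/-- From this position, `N` steps meet columns `k₀ - 1, …, 0` in the block of letter `a + 1`, then
columns `N - 1, …, k₀` in the next block. -/
theorem isWindow_of_inCol {r N : ℕ} {μ : YoungDiagram} {T : SemistandardYoungTableau μ}
    {a k₀ : ℕ} (hk₀ : k₀ ≤ N) (ha : a < r) (ha' : k₀ = N ∨ a + 1 < r)
    (h1 : ∀ k < k₀, InCol T k a) (h2 : ∀ k < N, k₀ ≤ k → InCol T k (a + 1)) :
    IsWindow N (r * N) (zeroSet r N T) (a * N + (N - k₀)) := by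
  have hlen : (a + 1) * N ≤ r * N := Nat.mul_le_mul_right N ha
  have e1 : (a + 1) * N = a * N + N := by ring
  refine ⟨?_, fun q hq1 hq2 hq => ?_⟩
  · rcases ha' with h | h
    · omega
    · have : (a + 1 + 1) * N ≤ r * N := Nat.mul_le_mul_right N h
      have e2 : (a + 1 + 1) * N = a * N + N + N := by ring
      omega
  · by_cases hqa : q < a * N + N
    · have hc : q - a * N < N := by omega
      have h3 := block_mem_zeroSet T ha hc
      rw [show a * N + (q - a * N) = q by omega] at h3
      exact h3.1 hq (h1 _ (by omega))
    · have hc : q - (a + 1) * N < N := by omega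
      have h3 := block_mem_zeroSet T (ha'.resolve_left (by omega)) hc
      rw [show (a + 1) * N + (q - (a + 1) * N) = q by omega] at h3
      exact h3.1 hq (h2 _ (by omega) (by omega))

/-- A strip has `n - r` boxes in distinct columns, and only `n - r` columns are available. -/
theorem exists_mem_isStrip {r n : ℕ} {μ : YoungDiagram}
    (hμ : ∀ i k : ℕ, (i, k) ∈ μ → i < r ∧ k < n - r) {S : Finset (ℕ × ℕ)}
    (hS : IsStrip r n μ S) {k : ℕ} (hk : k < n - r) : ∃ i, (i, k) ∈ S := by
  obtain ⟨hsub, hcard, hinj, -⟩ := hS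
  have himg : S.image Prod.snd = range (n - r) := by
    apply eq_of_subset_of_card_le
    · intro k hk
      obtain ⟨⟨i, k'⟩, hb, rfl⟩ := mem_image.1 hk
      exact mem_range.2 (hμ i k' ((YoungDiagram.mem_cells _).1 (hsub hb))).2
    · rw [card_range, card_image_of_injOn, hcard]
      intro b hb b' hb' he
      by_contra hne
      exact hinj b hb b' hb' hne he
  have := mem_range.2 hk
  rw [← himg, mem_image] at this
  obtain ⟨⟨i, k'⟩, hb, rfl⟩ := this
  exact ⟨i, hb⟩

theorem exists_isWindow_of_isSingleStrip {r n : ℕ} {μ : YoungDiagram}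
    (hμ : ∀ i k : ℕ, (i, k) ∈ μ → i < r ∧ k < n - r) {T : SemistandardYoungTableau μ} {i : ℕ}
    (hi : 1 ≤ i) (hir : i ≤ r) {S : Finset (ℕ × ℕ)} (hS : IsSingleStrip r n T i S) :
    ∃ Q, IsWindow (n - r) (r * (n - r)) (zeroSet r (n - r) T) Q := by
  refine ⟨_, isWindow_of_inCol (a := i - 1) le_rfl (by omega) (Or.inl rfl) (fun k hk => ?_)
    fun k h1 h2 => absurd h1 (not_lt.2 h2)⟩
  obtain ⟨x, hx⟩ := exists_mem_isStrip hμ hS.1 hk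
  have h1 : T x k = i := hS.2 _ hx
  exact ⟨x, YoungDiagram.mem_iff_lt_colLen.1 ((YoungDiagram.mem_cells _).1 (hS.1.1 hx)), by omega⟩

theorem exists_isWindow_of_isPairStrip {r n : ℕ} {μ : YoungDiagram}
    (hμ : ∀ i k : ℕ, (i, k) ∈ μ → i < r ∧ k < n - r) {T : SemistandardYoungTableau μ} {i : ℕ}
    (hi : 1 ≤ i) (hir : i + 1 ≤ r) {S : Finset (ℕ × ℕ)} (hS : IsPairStrip r n T i S) :
    ∃ Q, IsWindow (n - r) (r * (n - r)) (zeroSet r (n - r) T) Q := by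
  classical
  obtain ⟨hstrip, hval, hord⟩ := hS
  have hrow : ∀ {x k}, (x, k) ∈ S → x < μ.colLen k := fun hx =>
    YoungDiagram.mem_iff_lt_colLen.1 ((YoungDiagram.mem_cells _).1 (hstrip.1 hx))
  -- The switch column is the first one whose box carries `i + 1`, or `n - r` if there is none.
  have hex : ∃ k, n - r ≤ k ∨ ∃ x, (x, k) ∈ S ∧ T x k = i + 1 := ⟨n - r, Or.inl le_rfl⟩
  have hk₀ : Nat.find hex ≤ n - r := Nat.find_min' hex (Or.inl le_rfl)
  refine ⟨_, isWindow_of_inCol (a := i - 1) hk₀ (by omega) (Or.inr (by omega)) (fun k hk => ?_)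
    fun k h1 h2 => ?_⟩
  · have h1 := Nat.find_min hex hk
    push Not at h1
    obtain ⟨x, hx⟩ := exists_mem_isStrip hμ hstrip h1.1
    have h2 : T x k = i := (hval _ hx).resolve_right (h1.2 x hx)
    exact ⟨x, hrow hx, by omega⟩
  · obtain ⟨x, hx⟩ := exists_mem_isStrip hμ hstrip h1
    refine ⟨x, hrow hx, ?_⟩
    rcases hval _ hx with h3 | h3
    · obtain ⟨y, hy, h4⟩ := (Nat.find_spec hex).resolve_left (by omega)
      exact absurd (hord _ hx _ hy h3 h4) (not_lt.2 h2)
    · simp only at h3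
      omega

/-- A window yields one box per column with the right letters, but an arbitrary window may violate
the row condition. Choosing the leftmost window repairs this. -/
theorem not_isOneStripLess_of_isWindow {r n : ℕ} (hrn : r < n) {μ : YoungDiagram}
    {T : SemistandardYoungTableau μ}
    (h : ∃ Q, IsWindow (n - r) (r * (n - r)) (zeroSet r (n - r) T) Q) :
    ¬ IsOneStripLess r n T := by
  classical
  obtain ⟨N, hN⟩ : ∃ N, N = n - r := ⟨_, rfl⟩
  rw [← hN] at h
  have hNpos : 0 < N := by omega
  obtain ⟨Q, ⟨hQ, hw⟩, hmin⟩ : ∃ Q, IsWindow N (r * N) (zeroSet r N T) Q ∧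
      ∀ Q' < Q, ¬ IsWindow N (r * N) (zeroSet r N T) Q' :=
    ⟨Nat.find h, Nat.find_spec h, fun Q' => Nat.find_min h⟩
  obtain ⟨a, u, hu, rfl⟩ : ∃ a u, u < N ∧ Q = a * N + u :=
    ⟨Q / N, Q % N, Nat.mod_lt Q hNpos, by rw [mul_comm]; exact (Nat.div_add_mod Q N).symm⟩
  have e1 : (a + 1) * N = a * N + N := by ring
  have har : a < r := by
    by_contra h1
    have := Nat.mul_le_mul_right N (not_lt.1 h1)
    omega
  have har' : 0 < u → a + 1 < r := by
    intro hu0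
    by_contra h1
    have := Nat.mul_le_mul_right N (not_lt.1 h1)
    omega
  -- The window meets column `k` in the block of letter `f k + 1`.
  let f : ℕ → ℕ := fun k => if u + k < N then a else a + 1
  have hf : ∀ k < N, InCol T k (f k) := by
    intro k hk
    by_contra h1
    by_cases h2 : u + k < N
    · have hfk : f k = a := if_pos h2
      have h3 := block_mem_zeroSet T har (by omega : N - 1 - k < N)
      rw [show N - 1 - (N - 1 - k) = k by omega, ← hfk] at h3
      have h4 := h3.2 h1
      rw [hfk] at h4
      exact hw _ (by omega) (by omega) h4
    · have hfk : f k = a + 1 := if_neg h2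
      have h3 := block_mem_zeroSet T (har' (by omega)) (by omega : N - 1 - k < N)
      rw [show N - 1 - (N - 1 - k) = k by omega, ← hfk] at h3
      have h4 := h3.2 h1
      rw [hfk] at h4
      exact hw _ (by omega) (by omega) h4
  choose! row hrow hval using hf
  have hmem : ∀ {k}, k < N → (row k, k) ∈ μ := fun hk =>
    YoungDiagram.mem_iff_lt_colLen.2 (hrow _ hk)
  have hanti : ∀ k₁ k₂, k₂ < N → k₁ < k₂ → ¬ row k₁ < row k₂ := by
    intro k₁ k₂ hk₂ hlt hr
    have v1 := hval k₁ (by omega)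
    have v2 := hval k₂ hk₂
    have hm : (row k₂, k₁) ∈ μ := μ.up_left_mem le_rfl hlt.le (hmem hk₂)
    have w1 := T.col_strict hr hm
    have w2 := T.row_weak hlt (hmem hk₂)
    by_cases h1 : u + k₁ < N
    · by_cases h2 : u + k₂ < N
      · have f1 : f k₁ = a := if_pos h1
        have f2 : f k₂ = a := if_pos h2
        omega
      · have f1 : f k₁ = a := if_pos h1
        have f2 : f k₂ = a + 1 := if_neg h2
        have hu0 : 0 < u := by omega
        have hm1 : (row k₁, k₂) ∈ μ := μ.up_left_mem hr.le le_rfl (hmem hk₂)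
        have hm2 : (row k₁, N - u) ∈ μ := μ.up_left_mem le_rfl (by omega) hm1
        have w3 := T.col_strict hr (hmem hk₂)
        have w4 := T.row_weak (by omega : k₁ < N - u) hm2
        have w5 := T.row_weak_of_le (by omega : N - u ≤ k₂) hm1
        -- The entry in row `row k₁`, column `N - u` is squeezed between `a + 1` and a value below
        -- `a + 2`. Hence the position just before the window is a one, and the window could start
        -- one step earlier.
        have hin : InCol T (N - u) a :=
          ⟨row k₁, YoungDiagram.mem_iff_lt_colLen.1 hm2, by omega⟩
        refine hmin (a * N + (u - 1)) (by omega) ⟨by omega, fun q hq1 hq2 hq => ?_⟩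
        rcases hq1.eq_or_lt with rfl | hq3
        · have h3 := (block_mem_zeroSet T har (by omega : u - 1 < N)).1 hq
          rw [show N - 1 - (u - 1) = N - u by omega] at h3
          exact h3 hin
        · exact hw q (by omega) (by omega) hq
    · have f1 : f k₁ = a + 1 := if_neg h1
      have f2 : f k₂ = a + 1 := if_neg (by omega)
      omega
  let S : Finset (ℕ × ℕ) := (range N).image fun k => (row k, k)
  have hS : ∀ b ∈ S, b.2 < N ∧ b.1 = row b.2 := by
    intro b hb
    obtain ⟨k, hk, rfl⟩ := mem_image.1 hb
    exact ⟨mem_range.1 hk, rfl⟩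
  have hstrip : IsStrip r n μ S := by
    refine ⟨?_, ?_, ?_, ?_⟩
    · intro b hb
      obtain ⟨k, hk, rfl⟩ := mem_image.1 hb
      exact (YoungDiagram.mem_cells _).2 (hmem (mem_range.1 hk))
    · rw [card_image_of_injective _ fun k k' h => (Prod.mk.inj h).2, card_range, hN]
    · intro b₁ h1 b₂ h2 hne he
      apply hne
      refine Prod.ext ?_ he
      rw [(hS b₁ h1).2, (hS b₂ h2).2, he]
    · intro b₁ h1 b₂ h2 hlt
      rw [(hS b₁ h1).2, (hS b₂ h2).2]
      exact hanti _ _ (hS b₂ h2).1 hlt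
  have hSval : ∀ b ∈ S, T b.1 b.2 = f b.2 + 1 := by
    intro b hb
    rw [(hS b hb).2]
    exact hval _ (hS b hb).1
  rintro ⟨hpair, hsingle⟩
  rcases Nat.eq_zero_or_pos u with hu0 | hu0
  · refine hsingle (a + 1) (by omega) har ⟨S, hstrip, fun b hb => ?_⟩
    rw [hSval b hb]
    have : f b.2 = a := if_pos (by have := (hS b hb).1; omega)
    omega
  · refine hpair (a + 1) (by omega) (har' hu0) ⟨S, hstrip, fun b hb => ?_, ?_⟩
    · rw [hSval b hb]
      by_cases h1 : u + b.2 < N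
      · left
        rw [show f b.2 = a from if_pos h1]
      · right
        rw [show f b.2 = a + 1 from if_neg h1]
    · intro b₁ h1 b₂ h2 e1 e2
      rw [hSval b₁ h1] at e1
      rw [hSval b₂ h2] at e2
      have h3 : u + b₁.2 < N := by
        by_contra h3
        rw [show f b₁.2 = a + 1 from if_neg h3] at e1
        omega
      have h4 : ¬ u + b₂.2 < N := by
        intro h4
        rw [show f b₂.2 = a from if_pos h4] at e2
        omega
      omega

theorem isOneStripLess_iff {r n : ℕ} (hrn : r < n) {μ : YoungDiagram}
    (hμ : ∀ i k : ℕ, (i, k) ∈ μ → i < r ∧ k < n - r) (T : SemistandardYoungTableau μ) :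
    IsOneStripLess r n T ↔
      ¬ ∃ Q, IsWindow (n - r) (r * (n - r)) (zeroSet r (n - r) T) Q := by
  constructor
  · intro h1 h2
    exact not_isOneStripLess_of_isWindow hrn h2 h1
  · intro h
    refine ⟨fun i hi hir ⟨S, hS⟩ => h ?_, fun i hi hir ⟨S, hS⟩ => h ?_⟩
    · exact exists_isWindow_of_isPairStrip hμ hi hir hS
    · exact exists_isWindow_of_isSingleStrip hμ hi hir hS

end StripLess

/-! ### Both sides of the identity as counts of gap vectors. -/

namespace StripLess

open Finset

theorem card_eq_sum_colLen {r N : ℕ} {μ : YoungDiagram}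
    (hμ : ∀ i k : ℕ, (i, k) ∈ μ → i < r ∧ k < N) : μ.card = ∑ k ∈ range N, μ.colLen k := by
  rw [YoungDiagram.card, card_eq_sum_card_fiberwise (f := Prod.snd) (t := range N)]
  · refine sum_congr rfl fun k _ => ?_
    rw [YoungDiagram.colLen_eq_card, YoungDiagram.col]
  · rintro ⟨i, k⟩ hb
    exact mem_coe.2 (mem_range.2 (hμ i k ((YoungDiagram.mem_cells _).1 hb)).2)

theorem sum_sub_colLen {r N : ℕ} {μ : YoungDiagram}
    (hμ : ∀ i k : ℕ, (i, k) ∈ μ → i < r ∧ k < N) :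
    ∑ c ∈ range N, (r - μ.colLen (N - 1 - c)) = r * N - μ.card := by
  rw [sum_range_reflect (fun k => r - μ.colLen k) N, card_eq_sum_colLen hμ,
    sum_tsub_distrib _ fun k _ => colLen_le_of_forall_mem hμ k, sum_const, card_range, smul_eq_mul,
    mul_comm]

theorem numMaxParts_eq_colLen {r n : ℕ} (hrn : r < n) {μ : YoungDiagram}
    (hμ : ∀ i k : ℕ, (i, k) ∈ μ → i < r ∧ k < n - r) :
    numMaxParts r n μ = μ.colLen (n - r - 1) := by
  rw [numMaxParts, ← card_range (μ.colLen (n - r - 1))]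
  congr 1
  ext i
  rw [mem_filter, mem_range, mem_range, ← YoungDiagram.mem_iff_lt_colLen]
  constructor
  · rintro ⟨_, h⟩
    rw [YoungDiagram.mem_iff_lt_rowLen]
    omega
  · intro h
    refine ⟨(hμ _ _ h).1, ?_⟩
    have h1 := YoungDiagram.mem_iff_lt_rowLen.1 h
    by_contra h2
    have h3 : (i, n - r) ∈ μ := YoungDiagram.mem_iff_lt_rowLen.2 (by omega)
    exact absurd (hμ _ _ h3).2 (lt_irrefl _)

theorem colLen_removeRows (μ : YoungDiagram) (j k : ℕ) :
    (removeRows μ j).colLen k = μ.colLen k - j := by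
  refine eq_of_forall_lt_iff fun i => ?_
  rw [← YoungDiagram.mem_iff_lt_colLen, mem_removeRows, YoungDiagram.mem_iff_lt_colLen]
  omega

theorem ballotSets_congr {N L : ℕ} {h h' : ℕ → ℕ} (hh : ∀ c < N, h c = h' c) :
    ballotSets N L h = ballotSets N L h' := by
  ext Z
  simp only [ballotSets, Set.mem_ofPred_eq]
  refine and_congr_right fun _ => and_congr_left fun _ => ?_
  exact forall₂_congr fun c hc => by rw [hh c hc]

/-- Removing `j` full rows and `j` letters lowers column lengths and alphabet size equally, so each
column misses as many letters as before. -/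
theorem ballotSets_eq_of_le_colLen {r N j : ℕ} {μ : YoungDiagram}
    (hj : ∀ k < N, j ≤ μ.colLen k) :
    ballotSets N ((r - j) * N) (fun c => r - j - (removeRows μ j).colLen (N - 1 - c)) =
      ballotSets N ((r - j) * N) (fun c => r - μ.colLen (N - 1 - c)) := by
  refine ballotSets_congr fun c hc => ?_
  rw [colLen_removeRows]
  have := hj (N - 1 - c) (by omega)
  omega

theorem ncard_ssyt_removeRows {r N d j : ℕ} (hN : 0 < N) {μ : YoungDiagram}
    (hμ : ∀ i k : ℕ, (i, k) ∈ μ → i < r ∧ k < N) (hd : r * N - μ.card = d)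
    (hj : ∀ k < N, j ≤ μ.colLen k) :
    (ssyt (r - j) (removeRows μ j)).ncard =
      (gapVectors N d (fun c => r - μ.colLen (N - 1 - c)) (r * N) j).ncard := by
  have hjr : j ≤ r := (hj 0 hN).trans (colLen_le_of_forall_mem hμ 0)
  have hν : ∀ i k : ℕ, (i, k) ∈ removeRows μ j → i < r - j ∧ k < N := by
    intro i k h
    have := hμ _ _ ((mem_removeRows μ j i k).1 h)
    omega
  have h1 := bijOn_zeroImage (N := N) (d := d) (L := (r - j) * N) (j := j) hN
    ((sum_sub_colLen hμ).trans hd)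
  rw [← add_mul, Nat.sub_add_cancel hjr] at h1
  rw [h1.ncard_eq, (bijOn_zeroSet hν).ncard_eq, ballotSets_eq_of_le_colLen hj]

/-- Residue `0` belongs to the last column, which needs `r - μ.colLen (N - 1)` zeros, while only `r
- j` blocks are left. -/
theorem gapVectors_eq_empty {r N d j : ℕ} (hN : 0 < N) {μ : YoungDiagram}
    (hμ : ∀ i k : ℕ, (i, k) ∈ μ → i < r ∧ k < N) (hd : r * N - μ.card = d)
    (hj : μ.colLen (N - 1) < j) :
    gapVectors N d (fun c => r - μ.colLen (N - 1 - c)) (r * N) j = ∅ := by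
  refine Set.eq_empty_of_forall_notMem fun ℓ hℓ => ?_
  have hjr : j ≤ r := by
    by_contra h1
    have h2 := hℓ.2.1
    have h3 : (r + 1) * N ≤ j * N := Nat.mul_le_mul_right N (by omega)
    rw [add_mul, one_mul] at h3
    omega
  have h1 := bijOn_zeroImage (N := N) (d := d) (L := (r - j) * N) (j := j) hN
    ((sum_sub_colLen hμ).trans hd)
  rw [← add_mul, Nat.sub_add_cancel hjr] at h1
  have h2 := (h1.mapsTo hℓ).2.1 0 hN
  rw [residueCount_mul hN] at h2
  classical
  have h3 := Nat.count_le (p := fun b => b * N + 0 ∈ zeroImage d ℓ) (n := r - j)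
  rw [h2] at h3
  have h4 := colLen_le_of_forall_mem hμ (N - 1)
  simp only [Nat.sub_zero] at h3
  omega

/-- The terms with `j` beyond `m(μ)` vanish, so the sum may run over all possible numbers of marked
gaps. -/
theorem klyachkoCoeff_eq {r n : ℕ} (hrn : r < n) {μ : YoungDiagram}
    (hμ : ∀ i k : ℕ, (i, k) ∈ μ → i < r ∧ k < n - r) (hd : r * (n - r) - μ.card = n - 1) :
    klyachkoCoeff r n μ = ∑ j ∈ range (n - 1 + 2), (-1 : ℤ) ^ j * ((n - 1 + 1).choose j : ℤ) *
      ((gapVectors (n - r) (n - 1) (fun c => r - μ.colLen (n - r - 1 - c))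
        (r * (n - r)) j).ncard : ℤ) := by
  have hN : 0 < n - r := by omega
  have hm := numMaxParts_eq_colLen hrn hμ
  have hmr := colLen_le_of_forall_mem hμ (n - r - 1)
  have hsub : range (numMaxParts r n μ + 1) ⊆ range (n - 1 + 2) := by
    rw [range_subset_range]
    omega
  rw [← sum_subset hsub, klyachkoCoeff]
  · refine sum_congr rfl fun j hj => ?_
    rw [ncard_ssyt_removeRows hN hμ hd, Nat.sub_add_cancel (by omega : 1 ≤ n)]
    intro k hk
    rw [mem_range, hm] at hj
    have := μ.colLen_anti k (n - r - 1) (by omega)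
    omega
  · intro j _ hj
    rw [mem_range, hm] at hj
    rw [gapVectors_eq_empty hN hμ hd (by omega)]
    simp

theorem ncard_oneStripLessSSYT {r n : ℕ} (hrn : r < n) {μ : YoungDiagram}
    (hμ : ∀ i k : ℕ, (i, k) ∈ μ → i < r ∧ k < n - r) {d : ℕ} (hd : r * (n - r) - μ.card = d) :
    (oneStripLessSSYT r n μ).ncard =
      {ℓ ∈ gapVectors (n - r) d (fun c => r - μ.colLen (n - r - 1 - c)) (r * (n - r)) 0 |
        ∀ g ≤ d, ℓ g < n - r}.ncard := by
  have hN : 0 < n - r := by omega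
  have h1 := bijOn_zeroImage (N := n - r) (d := d) (L := r * (n - r)) (j := 0) hN
    ((sum_sub_colLen hμ).trans hd)
  rw [zero_mul, add_zero] at h1
  have h2 := bijOn_zeroSet hμ
  have h3 : oneStripLessSSYT r n μ = {T ∈ ssyt r μ |
      zeroSet r (n - r) T ∈ {Z | ¬ ∃ Q, IsWindow (n - r) (r * (n - r)) Z Q}} := by
    ext T
    exact and_congr_right fun _ => isOneStripLess_iff hrn hμ T
  have h4 : {ℓ ∈ gapVectors (n - r) d (fun c => r - μ.colLen (n - r - 1 - c)) (r * (n - r)) 0 |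
      ∀ g ≤ d, ℓ g < n - r} =
      {ℓ ∈ gapVectors (n - r) d (fun c => r - μ.colLen (n - r - 1 - c)) (r * (n - r)) 0 |
        zeroImage d ℓ ∈ {Z | ¬ ∃ Q, IsWindow (n - r) (r * (n - r)) Z Q}} := by
    ext ℓ
    refine and_congr_right fun hℓ => ?_
    have := hℓ.2.1
    exact forall_lt_iff_not_exists_isWindow hN (by omega)
  rw [h3, h4]
  have key : ∀ {α : Type} {f : α → Finset ℕ} {A : Set α} {B C : Set (Finset ℕ)},
      Set.BijOn f A B → {x ∈ A | f x ∈ C}.ncard = (B ∩ C).ncard :=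
    fun {_ _ _ _ _} h =>
      (h.inter_mapsTo (Set.mapsTo_preimage _ _) Set.inter_subset_right).ncard_eq
  rw [key h1, key h2]

end StripLess

theorem theorem1p4 (r n : ℕ) (hr : 1 ≤ r) (hrn : r < n) (μ : YoungDiagram)
    (hμ : ∀ i k : ℕ, (i, k) ∈ μ → i < r ∧ k < n - r)
    (hsize : μ.card = (r - 1) * (n - r - 1)) :
    StripLess.klyachkoCoeff r n μ = ((StripLess.oneStripLessSSYT r n μ).ncard : ℤ) ∧
      0 ≤ StripLess.klyachkoCoeff r n μ := by
  -- The size condition enters here: `n - 1` zeros leave `n` gaps, which matches `binom(n, j)`.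
  have hd : r * (n - r) - μ.card = n - 1 := by
    obtain ⟨a, rfl⟩ := Nat.exists_eq_add_of_le' hr
    obtain ⟨b, rfl⟩ := Nat.exists_eq_add_of_le hrn
    rw [hsize, show a + 1 + 1 + b - (a + 1) = b + 1 by omega, Nat.add_sub_cancel,
      Nat.add_sub_cancel]
    have : (a + 1) * (b + 1) = a * b + (a + b + 1) := by ring
    omega
  have hfin : (StripLess.gapVectors (n - r) (n - 1) (fun c => r - μ.colLen (n - r - 1 - c))
      (r * (n - r)) 0).Finite := by
    have h1 := StripLess.bijOn_zeroImage (N := n - r) (d := n - 1) (L := r * (n - r)) (j := 0)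
      (by omega) ((StripLess.sum_sub_colLen hμ).trans hd)
    rw [zero_mul, add_zero] at h1
    rw [h1.finite_iff_finite, ← (StripLess.bijOn_zeroSet hμ).finite_iff_finite]
    exact StripLess.ssyt_finite r μ
  have h : StripLess.klyachkoCoeff r n μ = ((StripLess.oneStripLessSSYT r n μ).ncard : ℤ) := by
    rw [StripLess.klyachkoCoeff_eq hrn hμ hd, StripLess.sum_neg_one_pow_ncard_gapVectors hfin,
      StripLess.ncard_oneStripLessSSYT hrn hμ hd]
  exact ⟨h, h ▸ Int.natCast_nonneg _⟩
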